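/- For every natural number $n$ and every $r>0$ let $G_r=\{(d,t,s): 0<d<r,\ t^2+s^2<r^2\}$, $D_r=\{(d,t): 0<d<r,\ |t|<r\}$, and let $\overline G_r$, $\overline D_r$ be these sets with the condition $0<d$ replaced by $0\le d$. Put $\Delta=\partial_d^2+\partial_t^2$ and $A=d^2\Delta-(n-1)d\,\partial_d-(n+1)$. Then there are functions $w\in C^\infty(\overline D_r)$ and $v\in C^\infty(\overline G_r)$ with the following properties. 1. (Gevrey estimates for $w$.) There is a constant $C>0$ such that, for all $k\in\mathbb N$ and $\alpha=(\alpha_1,\alpha_2)\in\mathbb N^2$, $$\|\partial^\alpha\Delta^k w\|_{L^2(D_r)}\le C^{|\alpha|+k+1}(2k)!\,(2\alpha)!,\qquad (2\alpha)!:=(2\alpha_1)!(2\alpha_2)!,$$ and, after enlarging $C$, the same estimates hold with the $C^2(D_r)$ norm in place of the $L^2(D_r)$ norm. However, $w$ is not analytic at the origin: no power series in $(d,t)$ converges to $w$ in the intersection of $\overline D_r$ with a neighbourhood of $(0,0)$. 2. (Convergent series.) For every $(d,t,s)\in G_r$ the series $$v(d,t,s)=\sum_{k=0}^\infty\frac{\big((-A/d)^k(d^{n+1}w)\big)(d,t)}{(2k)!}\,s^{2k}$$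 converges absolutely, and for each $k$ there is $h_k\in C^\infty(\overline D_r)$ with $(-A/d)^k(d^{n+1}w)=d^{n+1}h_k$ in $D_r$. 3. (Solution.) In $G_r$, $v$ solves $$d^2v_{dd}+d^2v_{tt}+d\,v_{ss}-(n-1)d\,v_d-(n+1)v=0,$$ and $v$ is of Gevrey class $2$: there is $C>0$ with $|\partial^\beta v|\le C^{|\beta|+1}(|\beta|!)^2$ in $G_r$ for all $\beta\in\mathbb N^3$; in particular $v$ is bounded. 4. (Non-analyticity.) $v(d,t,0)=d^{n+1}w(d,t)$ on $\overline D_r$, and $v$ is not analytic in $d$: no power series in $d$ converges to $v(d,0,0)$ on an interval $[0,\varepsilon)$, $\varepsilon>0$. 5. (Failure of local convergence.) There are functions $c_k(t,s)$, $k\ge0$, with $c_k=0$ for $k\le n$, such that for every $m$ one has $v-\sum_{k=0}^m c_k(t,s)d^k=O(d^{m+1})$ uniformly in $G_r$; and the boundary expansion $\sum_k c_k(0,0)d^k$ diverges for every $d>0$. -/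

import Mathlib

namespace BoundaryExpansion

/-- The partial derivative of `f` in the (coordinate) direction `e`. -/
noncomputable def pd {E : Type*} [AddCommGroup E] [Module ℝ E] (e : E) (f : E → ℝ) : E → ℝ :=
  fun x => lineDeriv ℝ f x e

/-! Functions of `(d, t)` live on `ℝ × ℝ`, functions of `(d, t, s)` on `ℝ × ℝ × ℝ`. -/

/-- The mixed partial derivative `∂_d ^ i ∂_t ^ j` of a function of `(d, t)`. -/
noncomputable def mixed₂ (i j : ℕ) (f : ℝ × ℝ → ℝ) : ℝ × ℝ → ℝ :=
  (pd ((1, 0) : ℝ × ℝ))^[i] ((pd ((0, 1) : ℝ × ℝ))^[j] f)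

/-- The mixed partial derivative `∂_d ^ i ∂_t ^ j ∂_s ^ l` of a function of `(d, t, s)`. -/
noncomputable def mixed₃ (i j l : ℕ) (f : ℝ × ℝ × ℝ → ℝ) : ℝ × ℝ × ℝ → ℝ :=
  (pd ((1, 0, 0) : ℝ × ℝ × ℝ))^[i]
    ((pd ((0, 1, 0) : ℝ × ℝ × ℝ))^[j] ((pd ((0, 0, 1) : ℝ × ℝ × ℝ))^[l] f))

/-- The Laplacian `∂_dd + ∂_tt` in the variables `(d, t)`. -/
noncomputable def laplacian (f : ℝ × ℝ → ℝ) : ℝ × ℝ → ℝ :=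
  fun x => mixed₂ 2 0 f x + mixed₂ 0 2 f x

/-- The operator `A = d² ∂_dd + d² ∂_tt - (n - 1) d ∂_d - (n + 1)`. -/
noncomputable def opA (n : ℕ) (f : ℝ × ℝ → ℝ) : ℝ × ℝ → ℝ :=
  fun x => x.1 ^ 2 * mixed₂ 2 0 f x + x.1 ^ 2 * mixed₂ 0 2 f x
    - ((n : ℝ) - 1) * x.1 * mixed₂ 1 0 f x - ((n : ℝ) + 1) * f x

/-- The operator `-A / d`. -/
noncomputable def negAdivD (n : ℕ) (f : ℝ × ℝ → ℝ) : ℝ × ℝ → ℝ :=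
  fun x => -(opA n f x) / x.1

/-- The degenerate operator
`v ↦ d² v_dd + d² v_tt + d v_ss - (n - 1) d v_d - (n + 1) v`. -/
noncomputable def modelOp (n : ℕ) (v : ℝ × ℝ × ℝ → ℝ) : ℝ × ℝ × ℝ → ℝ :=
  fun x => x.1 ^ 2 * mixed₃ 2 0 0 v x + x.1 ^ 2 * mixed₃ 0 2 0 v x + x.1 * mixed₃ 0 0 2 v x
    - ((n : ℝ) - 1) * x.1 * mixed₃ 1 0 0 v x - ((n : ℝ) + 1) * v x

/-- `G_r = {0 < d < r} × {t² + s² < r²}`. -/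
def domG (r : ℝ) : Set (ℝ × ℝ × ℝ) :=
  {x | 0 < x.1 ∧ x.1 < r ∧ x.2.1 ^ 2 + x.2.2 ^ 2 < r ^ 2}

/-- `G_r` together with its flat boundary portion `{d = 0}`. -/
def domGbar (r : ℝ) : Set (ℝ × ℝ × ℝ) :=
  {x | 0 ≤ x.1 ∧ x.1 < r ∧ x.2.1 ^ 2 + x.2.2 ^ 2 < r ^ 2}

/-- The slice `s = 0` of `G_r`, in the variables `(d, t)`. -/
def domD (r : ℝ) : Set (ℝ × ℝ) :=
  {x | 0 < x.1 ∧ x.1 < r ∧ x.2 ^ 2 < r ^ 2}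

/-- The slice `s = 0` together with its flat boundary portion `{d = 0}`: a neighbourhood of the
origin in the closed half plane `{d ≥ 0}`. -/
def domDbar (r : ℝ) : Set (ℝ × ℝ) :=
  {x | 0 ≤ x.1 ∧ x.1 < r ∧ x.2 ^ 2 < r ^ 2}

/-- `C ^ (|α| + k + 1) (2 k)! (2 α)!`, where `α = (i, j)`. -/
noncomputable def gevreyBound (C : ℝ) (i j k : ℕ) : ℝ :=
  C ^ (i + j + k + 1) * (Nat.factorial (2 * k) : ℝ) *
    ((Nat.factorial (2 * i) : ℝ) * (Nat.factorial (2 * j) : ℝ))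

/-- The estimates `‖∂^α Δ^k w‖ ≤ C ^ (|α| + k + 1) (2 k)! (2 α)!` in the norm of `L²`. -/
def GevreyL2 (r : ℝ) (w : ℝ × ℝ → ℝ) : Prop :=
  ∃ C : ℝ, 0 < C ∧ ∀ i j k : ℕ,
    MeasureTheory.eLpNorm (mixed₂ i j (laplacian^[k] w)) 2
      (MeasureTheory.volume.restrict (domD r)) ≤ ENNReal.ofReal (gevreyBound C i j k)

/-- The estimates `‖∂^α Δ^k w‖ ≤ C ^ (|α| + k + 1) (2 k)! (2 α)!` in the norm of `C²`. -/
def GevreyC2 (r : ℝ) (w : ℝ × ℝ → ℝ) : Prop :=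
  ∃ C : ℝ, 0 < C ∧ ∀ i j k : ℕ, ∀ p q : ℕ, p + q ≤ 2 → ∀ x ∈ domD r,
    |mixed₂ p q (mixed₂ i j (laplacian^[k] w)) x| ≤ gevreyBound C i j k

/-- Membership in the Gevrey space of order `2` on `G_r`, uniformly up to the boundary. -/
def GevreyTwo (r : ℝ) (v : ℝ × ℝ × ℝ → ℝ) : Prop :=
  ∃ C : ℝ, 0 < C ∧ ∀ i j l : ℕ, ∀ x ∈ domG r,
    |mixed₃ i j l v x| ≤ C ^ (i + j + l + 1) * ((Nat.factorial (i + j + l) : ℝ)) ^ 2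

/-- `∑ c_k(t, s) d^k` is the boundary expansion of `v` at `d = 0`: for every `m`, the remainder
`v - ∑_{k ≤ m} c_k d^k` is `O(d^(m+1))` on `G_r`. -/
def IsBoundaryExpansion (r : ℝ) (v : ℝ × ℝ × ℝ → ℝ) (c : ℕ → ℝ × ℝ → ℝ) : Prop :=
  ∀ m : ℕ, ∃ K : ℝ, ∀ x ∈ domG r,
    |v x - ∑ k ∈ Finset.range (m + 1), c k x.2 * x.1 ^ k| ≤ K * x.1 ^ (m + 1)

end BoundaryExpansion

open Set Filter Topology

namespace BoundaryExpansion

/-! ### Iterated partial derivatives on open sets -/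

section PartialDerivatives

variable {E : Type*} [NormedAddCommGroup E] [NormedSpace ℝ E]

/-! The witnesses are explicit: with `a² = n + 3` put `u = ∑ e^(-(a r + 2) m) e^(-m² d) cos(m² t)
cosh(a m s)`, `v = d^(n+1) u`, and let `w` be `u` at `s = 0`.

Algebra. Every mode is harmonic in `(d, t)` and `n + 1` is an indicial root of `A`, so `A(d^(n+1) f)
= (n + 3) d^(n+2) ∂_d f` for harmonic `f`. On modes, `-A/d` is therefore multiplication by `(n + 3)
m² = (a m)²`: the series in `s` is the expansion of `cosh(a m s)`, and the equation becomes `(n + 3)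
u_d + u_ss = 0` (`negAdivD_pow_mul_series`, `hasSum_series`, `modelOp_pow_mul_series`).

Size. The weight `e^(-a r m)` pays for `cosh` on `|s| ≤ r`, and `m^P e^(-2m) ≤ P! e^(-m)`. A
derivative in `d` or `t` costs `m²`, one in `s` costs `a m`, so `N` derivatives cost at most `(2N)!`
up to geometric factors: Gevrey class 2, uniformly up to `d = 0` (`abs_term_le`, `abs_powDeriv_le`).

Divergence. At the origin the `k`-th Taylor coefficient of `u` in `d` is `(-1)^k / k! * ∑ m^(2k)
e^(-(a r + 2) m)`, and the term `m = k` alone contributes at least `(k e^(-(a r + 2)))^k` in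
absolute value. The expansion thus has radius zero, and uniqueness of asymptotic expansions excludes
analyticity (`not_summable_boundaryCoeff`, `exists_summable_of_analyticWithinAt`). -/

lemma pd_eqOn {U : Set E} (hU : IsOpen U) (e : E) {f g : E → ℝ} (h : EqOn f g U) :
    EqOn (pd e f) (pd e g) U := fun _ hx =>
  Filter.EventuallyEq.lineDeriv_eq (h.eventuallyEq_of_mem (hU.mem_nhds hx))

lemma pd_iterate_eqOn_of_family {U : Set E} (hU : IsOpen U) (e : E) {f : E → ℝ}
    (G : ℕ → E → ℝ) (h0 : EqOn f (G 0) U)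
    (hG : ∀ k, ∀ x ∈ U, HasLineDerivAt ℝ (G k) (G (k + 1) x) x e) (i : ℕ) :
    EqOn ((pd e)^[i] f) (G i) U := by
  induction i with
  | zero => exact h0
  | succ i ih =>
    rw [Function.iterate_succ_apply']
    exact fun x hx => (pd_eqOn hU e ih hx).trans (hG i x hx).lineDeriv

lemma pd_iterate_eqOn {U : Set E} (hU : IsOpen U) (e : E) {f g : E → ℝ} (h : EqOn f g U)
    (i : ℕ) : EqOn ((pd e)^[i] f) ((pd e)^[i] g) U := by
  induction i with
  | zero => exact h
  | succ i ih =>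
    simp only [Function.iterate_succ_apply']
    exact pd_eqOn hU e ih

lemma pd_zero (e : E) : pd e (fun _ : E => (0 : ℝ)) = fun _ => 0 := by
  funext x
  simp [pd, lineDeriv]

lemma pd_iterate_zero (e : E) (i : ℕ) : (pd e)^[i] (fun _ : E => (0 : ℝ)) = fun _ => 0 :=
  Function.iterate_fixed (pd_zero e) i

end PartialDerivatives

lemma mixed₂_eqOn {U : Set (ℝ × ℝ)} (hU : IsOpen U) {f g : ℝ × ℝ → ℝ} (h : EqOn f g U)
    (i j : ℕ) : EqOn (mixed₂ i j f) (mixed₂ i j g) U :=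
  pd_iterate_eqOn hU _ (pd_iterate_eqOn hU _ h j) i

lemma mixed₂_zero (i j : ℕ) : mixed₂ i j (fun _ => (0 : ℝ)) = fun _ => 0 := by
  simp only [mixed₂, pd_iterate_zero]

lemma laplacian_eqOn {U : Set (ℝ × ℝ)} (hU : IsOpen U) {f g : ℝ × ℝ → ℝ} (h : EqOn f g U) :
    EqOn (laplacian f) (laplacian g) U := fun x hx => by
  simp only [laplacian, mixed₂_eqOn hU h _ _ hx]

lemma negAdivD_eqOn {U : Set (ℝ × ℝ)} (hU : IsOpen U) (n : ℕ) {f g : ℝ × ℝ → ℝ}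
    (h : EqOn f g U) : EqOn (negAdivD n f) (negAdivD n g) U := fun x hx => by
  simp only [negAdivD, opA, mixed₂_eqOn hU h _ _ hx, h hx]

/-- The inclusion of the slice `s = 0`. -/
def slice (y : ℝ × ℝ) : ℝ × ℝ × ℝ := (y.1, y.2, 0)

/-- No differentiability is needed: `slice` is linear, so both sides differentiate the same function
of one variable. This transfers the three-variable formulas to `w`. -/
lemma pd_comp_slice (e : ℝ × ℝ) (f : ℝ × ℝ × ℝ → ℝ) :
    pd e (f ∘ slice) = pd (slice e) f ∘ slice := by
  funext y
  simp [pd, lineDeriv, slice]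

lemma pd_iterate_comp_slice (e : ℝ × ℝ) (f : ℝ × ℝ × ℝ → ℝ) (i : ℕ) :
    (pd e)^[i] (f ∘ slice) = ((pd (slice e))^[i] f) ∘ slice := by
  induction i with
  | zero => rfl
  | succ i ih => simp only [Function.iterate_succ_apply', ih, pd_comp_slice]

lemma mixed₂_comp_slice (i j : ℕ) (f : ℝ × ℝ × ℝ → ℝ) :
    mixed₂ i j (f ∘ slice) = mixed₃ i j 0 f ∘ slice := by
  simp [mixed₂, mixed₃, pd_iterate_comp_slice, slice]

/-! ### The family of series -/

/-- `cosh` for even `l` and `sinh` for odd `l`. -/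
noncomputable def hyp (l : ℕ) (y : ℝ) : ℝ := (Real.exp y + (-1) ^ l * Real.exp (-y)) / 2

lemma hyp_zero (y : ℝ) : hyp 0 y = Real.cosh y := by simp [hyp, Real.cosh_eq]

lemma hyp_add_two (l : ℕ) (y : ℝ) : hyp (l + 2) y = hyp l y := by simp [hyp, pow_add]

lemma hasDerivAt_hyp (l : ℕ) (y : ℝ) : HasDerivAt (hyp l) (hyp (l + 1) y) y := by
  have h := ((Real.hasDerivAt_exp y).add
    ((Real.hasDerivAt_exp (-y)).comp y (hasDerivAt_neg y) |>.const_mul ((-1) ^ l))).div_const 2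
  refine HasDerivAt.congr_deriv (f := hyp l) h ?_
  simp only [hyp, pow_succ]
  ring

lemma abs_hyp_le (l : ℕ) (y : ℝ) : |hyp l y| ≤ Real.exp |y| := by
  have h1 : Real.exp y ≤ Real.exp |y| := Real.exp_le_exp.2 (le_abs_self y)
  have h2 : Real.exp (-y) ≤ Real.exp |y| := Real.exp_le_exp.2 (neg_le_abs y)
  have h3 := Real.exp_pos y
  have h4 := Real.exp_pos (-y)
  rw [hyp, abs_le]
  rcases neg_one_pow_eq_or ℝ l with h | h <;> rw [h] <;> constructor <;> linarith

/-- The terms of the series `series`. -/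
noncomputable def term (a r : ℝ) (P j l m : ℕ) (x : ℝ × ℝ × ℝ) : ℝ :=
  (m : ℝ) ^ P * Real.exp (-(a * r + 2) * m) *
    (Real.exp (-(m : ℝ) ^ 2 * x.1) * Real.cos ((m : ℝ) ^ 2 * x.2.1 + j * (Real.pi / 2)) *
      hyp l (a * m * x.2.2))

/-- `∑ m ^ P e ^ (-(a r + 2) m) e ^ (-m² d) cos (m² t + j π / 2) hyp_l (a m s)`, a family of
functions of `(d, t, s)` that is closed under partial derivatives. -/
noncomputable def series (a r : ℝ) (P j l : ℕ) (x : ℝ × ℝ × ℝ) : ℝ :=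
  ∑' m, term a r P j l m x

/-- The linear form on `ℝ × ℝ × ℝ` with the given coefficients. -/
noncomputable def linForm (α β γ : ℝ) : ℝ × ℝ × ℝ →L[ℝ] ℝ :=
  α • ContinuousLinearMap.fst ℝ ℝ (ℝ × ℝ) +
    β • (ContinuousLinearMap.fst ℝ ℝ ℝ ∘L ContinuousLinearMap.snd ℝ ℝ (ℝ × ℝ)) +
    γ • (ContinuousLinearMap.snd ℝ ℝ ℝ ∘L ContinuousLinearMap.snd ℝ ℝ (ℝ × ℝ))

@[simp] lemma linForm_apply (α β γ : ℝ) (e : ℝ × ℝ × ℝ) :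
    linForm α β γ e = α * e.1 + β * e.2.1 + γ * e.2.2 := by
  simp [linForm]

lemma norm_linForm_le (α β γ : ℝ) : ‖linForm α β γ‖ ≤ |α| + |β| + |γ| := by
  refine ContinuousLinearMap.opNorm_le_bound _ (by positivity) fun e => ?_
  have h1 : |e.1| ≤ ‖e‖ := norm_fst_le e
  have h2 : |e.2.1| ≤ ‖e‖ := (norm_fst_le e.2).trans (norm_snd_le e)
  have h3 : |e.2.2| ≤ ‖e‖ := (norm_snd_le e.2).trans (norm_snd_le e)
  rw [linForm_apply, Real.norm_eq_abs]
  refine (abs_add_three _ _ _).trans ?_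
  rw [abs_mul, abs_mul, abs_mul, add_mul, add_mul]
  gcongr

/-- The sign from `∂_d e^(-m² d)` is stored as a phase shift by `π`, that is `j + 2`, so
differentiation only shifts the indices, apart from the factor `a` for `∂_s`. -/
lemma hasFDerivAt_term (a r : ℝ) (P j l m : ℕ) (x : ℝ × ℝ × ℝ) :
    HasFDerivAt (term a r P j l m)
      (linForm (term a r (P + 2) (j + 2) l m x) (term a r (P + 2) (j + 1) l m x)
        (a * term a r (P + 1) j (l + 1) m x)) x := by
  have hd : HasFDerivAt (fun x : ℝ × ℝ × ℝ => Real.exp (-(m : ℝ) ^ 2 * x.1)) _ x :=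
    (((ContinuousLinearMap.fst ℝ ℝ (ℝ × ℝ)).hasFDerivAt (x := x)).const_mul
      (-(m : ℝ) ^ 2)).exp
  have ht : HasFDerivAt (fun x : ℝ × ℝ × ℝ =>
      Real.cos ((m : ℝ) ^ 2 * x.2.1 + j * (Real.pi / 2))) _ x :=
    (((((ContinuousLinearMap.fst ℝ ℝ ℝ ∘L
      ContinuousLinearMap.snd ℝ ℝ (ℝ × ℝ))).hasFDerivAt (x := x)).const_mul
      ((m : ℝ) ^ 2)).add_const (j * (Real.pi / 2))).cos
  have hs : HasFDerivAt (fun x : ℝ × ℝ × ℝ => hyp l (a * m * x.2.2)) _ x :=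
    (hasDerivAt_hyp l (a * m * x.2.2)).comp_hasFDerivAt (f := fun x => a * m * x.2.2) x
      (((ContinuousLinearMap.snd ℝ ℝ ℝ ∘L
        ContinuousLinearMap.snd ℝ ℝ (ℝ × ℝ))).hasFDerivAt (x := x) |>.const_mul (a * m))
  have h := ((hd.mul ht).mul hs).const_mul ((m : ℝ) ^ P * Real.exp (-(a * r + 2) * m))
  have e2 : Real.cos ((m : ℝ) ^ 2 * x.2.1 + ((j : ℝ) + 2) * (Real.pi / 2))
      = -Real.cos ((m : ℝ) ^ 2 * x.2.1 + j * (Real.pi / 2)) := by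
    rw [← Real.cos_add_pi]
    congr 1
    ring
  have e1 : Real.cos ((m : ℝ) ^ 2 * x.2.1 + ((j : ℝ) + 1) * (Real.pi / 2))
      = -Real.sin ((m : ℝ) ^ 2 * x.2.1 + j * (Real.pi / 2)) := by
    rw [← Real.cos_add_pi_div_two]
    congr 1
    ring
  refine h.congr_fderiv ?_
  ext <;> simp [term, e1, e2] <;> ring

/-! ### Bounds for the series -/

/-- The closed slab on which the series converges. -/
def slab (r : ℝ) : Set (ℝ × ℝ × ℝ) := Ici 0 ×ˢ (univ ×ˢ Icc (-r) r)

/-- The interior of `slab`. -/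
def openSlab (r : ℝ) : Set (ℝ × ℝ × ℝ) := Ioi 0 ×ˢ (univ ×ˢ Ioo (-r) r)

lemma isOpen_openSlab (r : ℝ) : IsOpen (openSlab r) :=
  isOpen_Ioi.prod (isOpen_univ.prod isOpen_Ioo)

lemma convex_openSlab (r : ℝ) : Convex ℝ (openSlab r) :=
  (convex_Ioi 0).prod (convex_univ.prod (convex_Ioo _ _))

lemma closure_openSlab {r : ℝ} (hr : 0 < r) : closure (openSlab r) = slab r := by
  rw [openSlab, slab, closure_prod_eq, closure_prod_eq, closure_Ioi, closure_univ,
    closure_Ioo (by linarith)]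

lemma openSlab_subset_slab {r : ℝ} (hr : 0 < r) : openSlab r ⊆ slab r :=
  closure_openSlab hr ▸ subset_closure

/-- The constant `∑ e ^ (-m)`. -/
noncomputable def expSum : ℝ := ∑' m : ℕ, Real.exp (-(m : ℝ))

lemma summable_exp_neg : Summable fun m : ℕ => Real.exp (-(m : ℝ)) := Real.summable_exp_neg_nat

lemma expSum_nonneg : 0 ≤ expSum := tsum_nonneg fun _ => (Real.exp_pos _).le

/-- Source of all factorials: `m^P / P!` is one term of the series of `e^m`. -/
lemma pow_mul_exp_le (P m : ℕ) :
    (m : ℝ) ^ P * Real.exp (-(2 * m)) ≤ P.factorial * Real.exp (-(m : ℝ)) := by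
  have h := Real.pow_div_factorial_le_exp (m : ℝ) m.cast_nonneg P
  rw [div_le_iff₀ (by positivity)] at h
  calc (m : ℝ) ^ P * Real.exp (-(2 * m)) ≤ Real.exp m * P.factorial * Real.exp (-(2 * m)) := by
        gcongr
    _ = P.factorial * Real.exp (-(m : ℝ)) := by
        rw [show -(m : ℝ) = m + -(2 * m) by ring, Real.exp_add]
        ring

lemma abs_term_le {a r : ℝ} (ha : 0 ≤ a) (P j l m : ℕ) {x : ℝ × ℝ × ℝ} (hx : x ∈ slab r) :
    |term a r P j l m x| ≤ P.factorial * Real.exp (-(m : ℝ)) := by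
  obtain ⟨hd, -, hs⟩ := hx
  have hd : 0 ≤ x.1 := hd
  have hs' : |x.2.2| ≤ r := abs_le.2 hs
  refine le_trans ?_ (pow_mul_exp_le P m)
  have h1 : Real.exp (-(m : ℝ) ^ 2 * x.1) ≤ 1 := by
    rw [Real.exp_le_one_iff]
    nlinarith [sq_nonneg (m : ℝ)]
  have h2 : |hyp l (a * m * x.2.2)| ≤ Real.exp (a * m * r) := by
    refine (abs_hyp_le _ _).trans (Real.exp_le_exp.2 ?_)
    rw [abs_mul, abs_of_nonneg (by positivity : 0 ≤ a * m)]
    gcongr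
  have h3 := Real.abs_cos_le_one ((m : ℝ) ^ 2 * x.2.1 + j * (Real.pi / 2))
  rw [term, abs_mul, abs_mul, abs_mul, abs_mul, Real.abs_exp, Real.abs_exp,
    abs_of_nonneg (by positivity : (0 : ℝ) ≤ (m : ℝ) ^ P)]
  calc _ ≤ (m : ℝ) ^ P * Real.exp (-(a * r + 2) * m) * (1 * 1 * Real.exp (a * m * r)) := by
        gcongr
    _ = (m : ℝ) ^ P * Real.exp (-(2 * m)) := by
        rw [one_mul, one_mul, mul_assoc, ← Real.exp_add]
        congr 2
        ring

lemma summable_term {a r : ℝ} (ha : 0 ≤ a) (P j l : ℕ) {x : ℝ × ℝ × ℝ} (hx : x ∈ slab r) :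
    Summable fun m => term a r P j l m x :=
  .of_norm_bounded (summable_exp_neg.mul_left _) fun m => abs_term_le ha P j l m hx

lemma abs_series_le {a r : ℝ} (ha : 0 ≤ a) (P j l : ℕ) {x : ℝ × ℝ × ℝ} (hx : x ∈ slab r) :
    |series a r P j l x| ≤ P.factorial * expSum := by
  rw [expSum, ← tsum_mul_left]
  exact tsum_of_norm_bounded (f := fun m => term a r P j l m x)
    (summable_exp_neg.mul_left _).hasSum fun m => abs_term_le ha P j l m hx

lemma series_add_two_phase (a r : ℝ) (P j l : ℕ) (x : ℝ × ℝ × ℝ) :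
    series a r P (j + 2) l x = -series a r P j l x := by
  rw [series, series, ← tsum_neg]
  congr 1
  funext m
  rw [term, term, show (m : ℝ) ^ 2 * x.2.1 + (j + 2 : ℕ) * (Real.pi / 2)
    = (m : ℝ) ^ 2 * x.2.1 + j * (Real.pi / 2) + Real.pi by push_cast; ring, Real.cos_add_pi]
  ring

lemma series_add_two_parity (a r : ℝ) (P j l : ℕ) (x : ℝ × ℝ × ℝ) :
    series a r P j (l + 2) x = series a r P j l x := by
  simp only [series, term, hyp_add_two]

/-! ### Smoothness of the series up to the boundary -/

lemma continuousOn_series {a r : ℝ} (ha : 0 ≤ a) (P j l : ℕ) :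
    ContinuousOn (series a r P j l) (slab r) := by
  refine continuousOn_tsum (fun m x _ => ?_) (summable_exp_neg.mul_left _)
    fun m x hx => abs_term_le ha P j l m hx
  exact (hasFDerivAt_term a r P j l m x).continuousAt.continuousWithinAt

/-- The differential of `series`. -/
noncomputable def seriesDeriv (a r : ℝ) (P j l : ℕ) (x : ℝ × ℝ × ℝ) : ℝ × ℝ × ℝ →L[ℝ] ℝ :=
  linForm (series a r (P + 2) (j + 2) l x) (series a r (P + 2) (j + 1) l x)
    (a * series a r (P + 1) j (l + 1) x)

lemma hasFDerivAt_series {a r : ℝ} (hr : 0 < r) (ha : 0 ≤ a) (P j l : ℕ) {x : ℝ × ℝ × ℝ}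
    (hx : x ∈ openSlab r) : HasFDerivAt (series a r P j l) (seriesDeriv a r P j l x) x := by
  have hsub := openSlab_subset_slab hr
  have h := hasFDerivAt_tsum_of_isPreconnected
    (u := fun m : ℕ => ((P + 2).factorial + (P + 2).factorial + a * (P + 1).factorial) *
      Real.exp (-(m : ℝ)))
    (summable_exp_neg.mul_left _) (isOpen_openSlab r) (convex_openSlab r).isPreconnected
    (fun m y _ => hasFDerivAt_term a r P j l m y) (fun m y hy => ?_) hx
    (summable_term ha P j l (hsub hx)) hx
  · refine h.congr_fderiv (HasSum.tsum_eq ?_)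
    exact (((summable_term ha _ _ _ (hsub hx)).hasSum.smul_const _).add
      ((summable_term ha _ _ _ (hsub hx)).hasSum.smul_const _)).add
      (((summable_term ha _ _ _ (hsub hx)).hasSum.mul_left a).smul_const _)
  · refine (norm_linForm_le _ _ _).trans ?_
    rw [abs_mul, abs_of_nonneg ha, add_mul, add_mul, mul_assoc]
    gcongr <;> exact abs_term_le ha _ _ _ m (hsub hy)

lemma continuousOn_seriesDeriv {a r : ℝ} (ha : 0 ≤ a) (P j l : ℕ) :
    ContinuousOn (seriesDeriv a r P j l) (slab r) :=
  (((continuousOn_series ha _ _ _).smul continuousOn_const).add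
    ((continuousOn_series ha _ _ _).smul continuousOn_const)).add
    (((continuousOn_series ha _ _ _).const_mul a).smul continuousOn_const)

/-- The interior differential extends continuously to the closure of a convex open set, so it is
also the differential within that closure. -/
lemma hasFDerivWithinAt_series {a r : ℝ} (hr : 0 < r) (ha : 0 ≤ a) (P j l : ℕ)
    {x : ℝ × ℝ × ℝ} (hx : x ∈ slab r) :
    HasFDerivWithinAt (series a r P j l) (seriesDeriv a r P j l x) (slab r) x := by
  have hsub := openSlab_subset_slab hr
  rw [← closure_openSlab hr]
  refine hasFDerivWithinAt_closure_of_tendsto_fderiv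
    (fun y hy => (hasFDerivAt_series hr ha P j l hy).differentiableAt.differentiableWithinAt)
    (convex_openSlab r) (isOpen_openSlab r)
    (fun y hy => (continuousOn_series ha P j l y (closure_openSlab hr ▸ hy)).mono hsub) ?_
  refine ((continuousOn_seriesDeriv ha P j l x hx).mono hsub).congr' ?_
  filter_upwards [self_mem_nhdsWithin] with y hy
  exact (hasFDerivAt_series hr ha P j l hy).fderiv.symm

lemma contDiffOn_series {a r : ℝ} (hr : 0 < r) (ha : 0 ≤ a) (P j l : ℕ) :
    ContDiffOn ℝ ((⊤ : ℕ∞) : WithTop ℕ∞) (series a r P j l) (slab r) := by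
  rw [contDiffOn_infty]
  intro N
  induction N generalizing P j l with
  | zero => exact contDiffOn_zero.2 (continuousOn_series ha P j l)
  -- The differential is built from members of the same family, so the induction runs over all
  -- indices at once.
  | succ N ih =>
    push_cast
    rw [contDiffOn_succ_iff_hasFDerivWithinAt (by simp)]
    intro x hx
    refine ⟨slab r, by rw [insert_eq_of_mem hx]; exact self_mem_nhdsWithin, by simp,
      seriesDeriv a r P j l, fun y hy => hasFDerivWithinAt_series hr ha P j l hy, ?_⟩
    exact (((ih _ _ _).smul contDiffOn_const).add ((ih _ _ _).smul contDiffOn_const)).add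
      ((contDiffOn_const.mul (ih _ _ _)).smul contDiffOn_const)

/-! ### Derivatives of `d ^ q * series` -/

/-- The `i`-th `d`-derivative of `d ^ q * series a r P j l` in `openSlab r`. -/
noncomputable def powDeriv (a r : ℝ) (l : ℕ) : ℕ → ℕ → ℕ → ℕ → ℝ × ℝ × ℝ → ℝ
  | 0, q, P, j => fun x => x.1 ^ q * series a r P j l x
  | i + 1, q, P, j => fun x =>
      q * powDeriv a r l i (q - 1) P j x + powDeriv a r l i q (P + 2) (j + 2) x

/-- The truncated `q - 1` in `powDeriv` is harmless at `q = 0`, since its coefficient `q` vanishes.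
-/
lemma powDeriv_zero_pow (a r : ℝ) (l i P j : ℕ) (x : ℝ × ℝ × ℝ) :
    powDeriv a r l i 0 P j x = series a r (P + 2 * i) (j + 2 * i) l x := by
  induction i generalizing P j with
  | zero => simp [powDeriv]
  | succ i ih =>
    simp only [powDeriv, ih, Nat.cast_zero, zero_mul, zero_add]
    congr 1 <;> ring

lemma hasLineDerivAt_pow_mul_series {a r : ℝ} (hr : 0 < r) (ha : 0 ≤ a) (q P j l : ℕ)
    {x : ℝ × ℝ × ℝ} (hx : x ∈ openSlab r) (e : ℝ × ℝ × ℝ) :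
    HasLineDerivAt ℝ (fun x => x.1 ^ q * series a r P j l x)
      (x.1 ^ q * seriesDeriv a r P j l x e +
        q * x.1 ^ (q - 1) * e.1 * series a r P j l x) x e := by
  have h1 : HasFDerivAt (fun x : ℝ × ℝ × ℝ => x.1 ^ q) _ x :=
    (ContinuousLinearMap.fst ℝ ℝ (ℝ × ℝ)).hasFDerivAt.pow q
  have h := (h1.mul (hasFDerivAt_series hr ha P j l hx)).hasLineDerivAt e
  refine HasDerivAt.congr_deriv h ?_
  simp
  ring

lemma hasLineDerivAt_powDeriv {a r : ℝ} (hr : 0 < r) (ha : 0 ≤ a) (l i q P j : ℕ)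
    {x : ℝ × ℝ × ℝ} (hx : x ∈ openSlab r) :
    HasLineDerivAt ℝ (powDeriv a r l i q P j) (powDeriv a r l (i + 1) q P j x) x (1, 0, 0) := by
  induction i generalizing q P j with
  | zero =>
    refine (hasLineDerivAt_pow_mul_series hr ha q P j l hx _).congr_deriv ?_
    simp [powDeriv, seriesDeriv]
    ring
  | succ i ih =>
    exact HasDerivAt.add (HasDerivAt.const_mul (q : ℝ) (ih (q - 1) P j)) (ih q (P + 2) (j + 2))

lemma mixed₃_pow_mul_series {a r : ℝ} (hr : 0 < r) (ha : 0 ≤ a) (b : ℝ) (q P J L i j l : ℕ)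
    {f : ℝ × ℝ × ℝ → ℝ} (hf : EqOn f (fun x => b * (x.1 ^ q * series a r P J L x)) (openSlab r)) :
    EqOn (mixed₃ i j l f)
      (fun x => b * a ^ l * powDeriv a r (L + l) i q (P + l + 2 * j) (J + j) x) (openSlab r) := by
  have ho := isOpen_openSlab r
  refine pd_iterate_eqOn_of_family ho _
    (fun k x => b * a ^ l * powDeriv a r (L + l) k q (P + l + 2 * j) (J + j) x) ?_
    (fun k x hx => HasDerivAt.const_mul _ (hasLineDerivAt_powDeriv hr ha _ _ _ _ _ hx)) i
  refine pd_iterate_eqOn_of_family ho _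
    (fun k x => b * a ^ l * (x.1 ^ q * series a r (P + l + 2 * k) (J + k) (L + l) x)) ?_
    (fun k x hx => ?_) j
  · refine pd_iterate_eqOn_of_family ho _
      (fun k x => b * a ^ k * (x.1 ^ q * series a r (P + k) J (L + k) x)) ?_
      (fun k x hx => ?_) l
    · simpa using hf
    · refine (HasDerivAt.const_mul (b * a ^ k)
        (hasLineDerivAt_pow_mul_series hr ha q (P + k) J (L + k) hx _)).congr_deriv ?_
      simp [seriesDeriv, pow_succ, add_assoc]
      ring
  · refine (HasDerivAt.const_mul (b * a ^ l)
      (hasLineDerivAt_pow_mul_series hr ha q (P + l + 2 * k) (J + k) (L + l) hx _)).congr_deriv ?_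
    simp [seriesDeriv, mul_add, add_assoc]

/-! ### The slice -/

/-- The half strip containing `domD r`. -/
def openStrip : Set (ℝ × ℝ) := Ioi 0 ×ˢ univ

lemma isOpen_openStrip : IsOpen openStrip := isOpen_Ioi.prod isOpen_univ

lemma mapsTo_slice {r : ℝ} (hr : 0 < r) : MapsTo slice openStrip (openSlab r) :=
  fun _ hx => ⟨hx.1, mem_univ _, by simp [slice, hr]⟩

lemma mixed₂_pow_mul_series {a r : ℝ} (hr : 0 < r) (ha : 0 ≤ a) (b : ℝ) (q P J i j : ℕ)
    {f : ℝ × ℝ → ℝ}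
    (hf : EqOn f (fun y => b * (y.1 ^ q * series a r P J 0 (slice y))) openStrip) :
    EqOn (mixed₂ i j f)
      (fun y => b * powDeriv a r 0 i q (P + 2 * j) (J + j) (slice y)) openStrip := by
  intro y hy
  rw [mixed₂_eqOn isOpen_openStrip hf i j hy]
  change mixed₂ i j ((fun x => b * (x.1 ^ q * series a r P J 0 x)) ∘ slice) y = _
  rw [mixed₂_comp_slice]
  simpa using mixed₃_pow_mul_series hr ha b q P J 0 i j 0 (eqOn_refl _ _) (mapsTo_slice hr hy)

lemma mixed₂_series {a r : ℝ} (hr : 0 < r) (ha : 0 ≤ a) (P J i j : ℕ)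
    {f : ℝ × ℝ → ℝ} (hf : EqOn f (fun y => series a r P J 0 (slice y)) openStrip) :
    EqOn (mixed₂ i j f)
      (fun y => series a r (P + 2 * j + 2 * i) (J + j + 2 * i) 0 (slice y)) openStrip := by
  have h := mixed₂_pow_mul_series hr ha 1 0 P J i j (f := f) (by simpa using hf)
  simpa only [powDeriv_zero_pow, one_mul] using h

/-- `∂_d²` and `∂_t²` both multiply by `m⁴`, with phases two steps apart, hence opposite signs. -/
lemma laplacian_series {a r : ℝ} (hr : 0 < r) (ha : 0 ≤ a) (P J : ℕ) :
    EqOn (laplacian fun y => series a r P J 0 (slice y)) (fun _ => 0) openStrip := by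
  intro y hy
  rw [laplacian, mixed₂_series hr ha P J 2 0 (eqOn_refl _ _) hy,
    mixed₂_series hr ha P J 0 2 (eqOn_refl _ _) hy]
  simp only [mul_zero, add_zero]
  rw [show J + 2 * 2 = J + 2 + 2 by ring, series_add_two_phase]
  ring

lemma laplacian_iterate_series {a r : ℝ} (hr : 0 < r) (ha : 0 ≤ a) (P J k : ℕ) :
    EqOn (laplacian^[k + 1] fun y => series a r P J 0 (slice y)) (fun _ => 0) openStrip := by
  induction k with
  | zero => exact laplacian_series hr ha P J
  | succ k ih =>
    intro y hy
    rw [Function.iterate_succ_apply', laplacian_eqOn isOpen_openStrip ih hy]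
    simp [laplacian, mixed₂_zero]

/-! ### The degenerate operators -/

/-- Removes the truncated exponent `n - 1` from the second derivative of `d^(n+1)`, including `n =
0`. -/
lemma pow_mul_indicial (n : ℕ) (d : ℝ) :
    d ^ 2 * (((n + 1 : ℕ) : ℝ) * ((n : ℕ) * d ^ (n - 1))) = (n + 1) * n * d ^ (n + 1) := by
  cases n with
  | zero => simp
  | succ n =>
    simp only [Nat.add_sub_cancel]
    push_cast
    ring

/-- The order-zero terms cancel because `(n+1)n - (n-1)(n+1) - (n+1) = 0`; the first-order ones add
up to `2(n+1) - (n-1) = n + 3`; harmonicity removes the rest. -/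
lemma negAdivD_pow_mul_series {a r : ℝ} (hr : 0 < r) (ha : 0 ≤ a) (n : ℕ) (b : ℝ) (P : ℕ) :
    EqOn (negAdivD n fun y => b * (y.1 ^ (n + 1) * series a r P 0 0 (slice y)))
      (fun y => b * (n + 3) * (y.1 ^ (n + 1) * series a r (P + 2) 0 0 (slice y)))
      openStrip := by
  intro y hy
  have hy0 : y.1 ≠ 0 := ne_of_gt hy.1
  have hm := fun i j => mixed₂_pow_mul_series hr ha b (n + 1) P 0 i j (eqOn_refl _ _) hy
  have h4 := series_add_two_phase a r (P + 4) 2 0 (slice y)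
  have h2 := series_add_two_phase a r (P + 2) 0 0 (slice y)
  rw [negAdivD, opA, hm 2 0, hm 0 2, hm 1 0, div_eq_iff hy0]
  simp only [powDeriv, mul_zero, zero_add, add_zero, Nat.add_sub_cancel]
  norm_num only at h4 h2 ⊢
  rw [h4, h2]
  have hp := pow_mul_indicial n y.1
  push_cast at hp ⊢
  have hs : (slice y).1 = y.1 := rfl
  rw [hs]
  linear_combination (-b * series a r P 0 0 (slice y)) * hp

lemma negAdivD_iterate_pow_mul_series {a r : ℝ} (hr : 0 < r) (ha : 0 ≤ a) (n k : ℕ) :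
    EqOn ((negAdivD n)^[k] fun y => y.1 ^ (n + 1) * series a r 0 0 0 (slice y))
      (fun y => ((n : ℝ) + 3) ^ k * (y.1 ^ (n + 1) * series a r (2 * k) 0 0 (slice y)))
      openStrip := by
  induction k with
  | zero => intro y _; simp
  | succ k ih =>
    intro y hy
    rw [Function.iterate_succ_apply', negAdivD_eqOn isOpen_openStrip n ih hy,
      negAdivD_pow_mul_series hr ha n _ _ hy, pow_succ, mul_add_one]

lemma modelOp_pow_mul_series {a r : ℝ} (hr : 0 < r) (ha : 0 ≤ a) (n : ℕ)
    (han : a ^ 2 = n + 3) :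
    EqOn (modelOp n fun x => x.1 ^ (n + 1) * series a r 0 0 0 x) (fun _ => 0) (openSlab r) := by
  intro x hx
  have hm := fun i j l => mixed₃_pow_mul_series hr ha 1 (n + 1) 0 0 0 i j l
    (f := fun x => x.1 ^ (n + 1) * series a r 0 0 0 x) (by simpa using eqOn_refl _ _) hx
  have h4 := series_add_two_phase a r 4 2 0 x
  have h2 := series_add_two_phase a r 2 0 0 x
  have hl := series_add_two_parity a r 2 0 0 x
  rw [modelOp, hm 2 0 0, hm 0 2 0, hm 0 0 2, hm 1 0 0]
  simp only [powDeriv, mul_zero, zero_add, add_zero, Nat.add_sub_cancel]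
  norm_num only at h4 h2 hl ⊢
  rw [h4, h2, hl, han]
  have hp := pow_mul_indicial n x.1
  push_cast at hp ⊢
  linear_combination (series a r 0 0 0 x) * hp

/-! ### Gevrey estimates -/

lemma factorial_add_le (m n : ℕ) :
    ((m + n).factorial : ℝ) ≤ 2 ^ (m + n) * (m.factorial * n.factorial) := by
  rw [← Nat.add_choose_mul_factorial_mul_factorial m n]
  push_cast
  rw [mul_assoc]
  gcongr
  exact_mod_cast Nat.choose_le_two_pow _ _

lemma mul_pow_le_pow_succ {Q B : ℝ} (hQ : 0 ≤ Q) (hB : 0 ≤ B) (N : ℕ) :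
    Q * B ^ N ≤ (Q + B + 1) ^ (N + 1) := by
  rw [pow_succ']
  gcongr <;> linarith

/-- The fixed bound `N` on `q` lets the induction pass to `q - 1`; one `d`-derivative costs `q ≤ N`
from the power plus `1` from the series. -/
lemma abs_powDeriv_le {a r R : ℝ} (ha : 0 ≤ a) (hR : 1 ≤ R) (l i N : ℕ) {q : ℕ} (hq : q ≤ N)
    (P j : ℕ) {x : ℝ × ℝ × ℝ} (hx : x ∈ slab r) (hxR : x.1 ≤ R) :
    |powDeriv a r l i q P j x| ≤
      R ^ N * (N + 1) ^ i * ((P + 2 * i).factorial * expSum) := by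
  have hx0 : 0 ≤ x.1 := hx.1
  have hS := expSum_nonneg
  induction i generalizing q P j with
  | zero =>
    rw [powDeriv, abs_mul, abs_pow, abs_of_nonneg hx0, pow_zero, mul_one]
    have h1 : x.1 ^ q ≤ R ^ N := (pow_le_pow_left₀ hx0 hxR q).trans (pow_le_pow_right₀ hR hq)
    exact mul_le_mul h1 (abs_series_le ha P j l hx) (abs_nonneg _) (by positivity)
  | succ i ih =>
    have h1 := ih ((Nat.sub_le q 1).trans hq) P j
    have h2 := ih hq (P + 2) (j + 2)
    rw [show P + 2 + 2 * i = P + 2 * (i + 1) by ring] at h2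
    have hf : ((P + 2 * i).factorial : ℝ) ≤ (P + 2 * (i + 1)).factorial := by
      exact_mod_cast Nat.factorial_le (by omega)
    have hqN : (q : ℝ) ≤ N := by exact_mod_cast hq
    simp only [powDeriv]
    refine (abs_add_le _ _).trans ?_
    rw [abs_mul, Nat.abs_cast]
    calc _ ≤ (N : ℝ) * (R ^ N * (N + 1) ^ i * ((P + 2 * (i + 1)).factorial * expSum)) +
          R ^ N * (N + 1) ^ i * ((P + 2 * (i + 1)).factorial * expSum) := by
          refine add_le_add (mul_le_mul hqN (h1.trans ?_) (abs_nonneg _) (by positivity)) h2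
          gcongr
      _ = _ := by ring

lemma domG_subset_openSlab {r : ℝ} (hr : 0 < r) : domG r ⊆ openSlab r := fun x hx =>
  ⟨hx.1, mem_univ _, abs_lt.1 (abs_lt_of_sq_lt_sq (by nlinarith [hx.2.2, sq_nonneg x.2.1]) hr.le)⟩

lemma domGbar_subset_slab {r : ℝ} (hr : 0 < r) : domGbar r ⊆ slab r := fun x hx =>
  ⟨hx.1, mem_univ _, abs_le.1
    (abs_lt_of_sq_lt_sq (by nlinarith [hx.2.2, sq_nonneg x.2.1]) hr.le).le⟩

lemma slice_mem_slab {r : ℝ} (hr : 0 < r) {y : ℝ × ℝ} (hy : 0 ≤ y.1) : slice y ∈ slab r :=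
  ⟨hy, mem_univ _, by simp [slice, hr.le]⟩

lemma domD_subset_openStrip (r : ℝ) : domD r ⊆ openStrip := fun _ hx => ⟨hx.1, mem_univ _⟩

lemma gevreyTwo_pow_mul_series {a r : ℝ} (hr : 0 < r) (ha : 0 ≤ a) (q : ℕ) :
    GevreyTwo r fun x => x.1 ^ q * series a r 0 0 0 x := by
  have hS := expSum_nonneg
  refine ⟨(1 + r) ^ q * expSum + (a + 1) * (q + 1) * 4 + 1, by positivity,
    fun i j l x hx => ?_⟩
  have hx' := domG_subset_openSlab hr hx
  rw [mixed₃_pow_mul_series hr ha 1 q 0 0 0 i j l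
    (f := fun x => x.1 ^ q * series a r 0 0 0 x) (by simpa using eqOn_refl _ _) hx']
  set N := i + j + l with hN
  have h1 := abs_powDeriv_le (R := 1 + r) ha (by linarith) (0 + l) i q le_rfl
    (0 + l + 2 * j) (0 + j) (openSlab_subset_slab hr hx') (by linarith [hx.2.1])
  -- The Gevrey order appears here: `(2N)! ≤ 4^N (N!)²`.
  have h2 : ((0 + l + 2 * j + 2 * i).factorial : ℝ) ≤ 4 ^ N * (N.factorial : ℝ) ^ 2 := by
    have h3 : ((0 + l + 2 * j + 2 * i).factorial : ℝ) ≤ (N + N).factorial := by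
      exact_mod_cast Nat.factorial_le (by omega)
    refine h3.trans ((factorial_add_le N N).trans_eq ?_)
    rw [← two_mul, pow_mul]
    norm_num
    ring
  have h4 : a ^ l ≤ (a + 1) ^ N :=
    (pow_le_pow_left₀ ha (by linarith) l).trans (pow_le_pow_right₀ (by linarith) (by omega))
  have h5 : ((q : ℝ) + 1) ^ i ≤ (q + 1) ^ N := pow_le_pow_right₀ (by simp) (by omega)
  rw [one_mul, abs_mul, abs_of_nonneg (by positivity : 0 ≤ a ^ l)]
  calc _ ≤ (a + 1) ^ N * ((1 + r) ^ q * (q + 1) ^ N *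
        ((4 ^ N * (N.factorial : ℝ) ^ 2) * expSum)) := by
        refine mul_le_mul h4 (h1.trans ?_) (abs_nonneg _) (by positivity)
        gcongr
    _ = (1 + r) ^ q * expSum * ((a + 1) * (q + 1) * 4) ^ N * (N.factorial : ℝ) ^ 2 := by
        rw [mul_pow, mul_pow]
        ring
    _ ≤ _ := by
        gcongr
        exact mul_pow_le_pow_succ (by positivity) (by positivity) N

lemma gevreyBound_nonneg {C : ℝ} (hC : 0 ≤ C) (i j k : ℕ) : 0 ≤ gevreyBound C i j k := by
  unfold gevreyBound
  positivity

lemma gevreyC2_series {a r : ℝ} (hr : 0 < r) (ha : 0 ≤ a) :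
    GevreyC2 r fun y => series a r 0 0 0 (slice y) := by
  have hS := expSum_nonneg
  -- Two factorial splittings give `2^(2i+2j+4) * 2^(2i+2j) * 4!`, which is `384 * 16^(i+j)`; the
  -- `4` is the cost of two extra derivatives. Only `k = 0` matters, as `w` is harmonic.
  refine ⟨384 * expSum + 16 + 1, by positivity, fun i j k p q hpq x hx => ?_⟩
  have hx' := domD_subset_openStrip r hx
  rcases k with _ | k
  · rw [Function.iterate_zero, id,
      mixed₂_series hr ha _ _ p q (mixed₂_series hr ha 0 0 i j (eqOn_refl _ _)) hx']
    refine (abs_series_le ha _ _ _ (openSlab_subset_slab hr (mapsTo_slice hr hx'))).trans ?_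
    have h1 : ((0 + 2 * j + 2 * i + 2 * q + 2 * p).factorial : ℝ)
        ≤ (2 * i + 2 * j + 4).factorial := by
      exact_mod_cast Nat.factorial_le (by omega)
    have h2 := factorial_add_le (2 * i + 2 * j) 4
    have h3 := factorial_add_le (2 * i) (2 * j)
    calc _ ≤ 2 ^ (2 * i + 2 * j + 4) * ((2 ^ (2 * i + 2 * j) *
          ((2 * i).factorial * (2 * j).factorial)) * (4).factorial) * expSum := by
          gcongr
          refine h1.trans (h2.trans ?_)
          gcongr
      _ = 384 * expSum * 16 ^ (i + j) * ((2 * i).factorial * (2 * j).factorial) := by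
          rw [show (16 : ℝ) = 2 ^ 4 by norm_num, ← pow_mul, show 4 * (i + j)
            = (2 * i + 2 * j) + (2 * i + 2 * j) by ring, pow_add _ _ 4, pow_add]
          norm_num [Nat.factorial]
          ring
      _ ≤ _ := by
          rw [gevreyBound, mul_zero, Nat.factorial_zero, Nat.cast_one, mul_one, add_zero]
          gcongr
          exact mul_pow_le_pow_succ (by positivity) (by positivity) _
  · rw [mixed₂_eqOn isOpen_openStrip (mixed₂_eqOn isOpen_openStrip
      (laplacian_iterate_series hr ha 0 0 k) i j) p q hx', mixed₂_zero, mixed₂_zero, abs_zero]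
    exact gevreyBound_nonneg (by positivity) _ _ _

lemma volume_domD_lt_top (r : ℝ) : MeasureTheory.volume (domD r) < ⊤ := by
  refine Bornology.IsBounded.measure_lt_top
    ((Metric.isBounded_Icc (0 : ℝ) r).prod (Metric.isBounded_Icc (-|r|) |r|) |>.subset ?_)
  exact fun x hx => ⟨⟨hx.1.le, hx.2.1.le⟩, abs_le.1 (sq_lt_sq.1 hx.2.2).le⟩

lemma measurableSet_domD (r : ℝ) : MeasurableSet (domD r) := by
  refine IsOpen.measurableSet ((isOpen_lt continuous_const continuous_fst).inter
    ((isOpen_lt continuous_fst continuous_const).inter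
      (isOpen_lt (continuous_snd.pow 2) continuous_const)))

lemma GevreyC2.gevreyL2 {r : ℝ} {w : ℝ × ℝ → ℝ} (h : GevreyC2 r w) : GevreyL2 r w := by
  obtain ⟨C, hC, h⟩ := h
  -- The square root of the volume converts a sup bound into an `L²` bound and is absorbed into the
  -- constant.
  set M := MeasureTheory.volume (domD r) ^ (2 : ENNReal).toReal⁻¹ with hM
  have hMt : M ≠ ⊤ := ENNReal.rpow_ne_top_of_nonneg (by positivity) (volume_domD_lt_top r).ne
  have hM0 : 0 ≤ M.toReal := ENNReal.toReal_nonneg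
  refine ⟨(M.toReal + 1) * C, by positivity, fun i j k => ?_⟩
  have hb : ∀ᵐ x ∂(MeasureTheory.volume.restrict (domD r)),
      ‖mixed₂ i j (laplacian^[k] w) x‖ ≤ gevreyBound C i j k :=
    (MeasureTheory.ae_restrict_iff' (measurableSet_domD r)).2
      (.of_forall fun x hx => h i j k 0 0 (by norm_num) x hx)
  refine (MeasureTheory.eLpNorm_le_of_ae_bound hb).trans ?_
  have hMg : M * ENNReal.ofReal (gevreyBound C i j k)
      = ENNReal.ofReal (M.toReal * gevreyBound C i j k) := by
    rw [ENNReal.ofReal_mul hM0, ENNReal.ofReal_toReal hMt]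
  rw [MeasureTheory.Measure.restrict_apply_univ, ← hM, hMg]
  refine ENNReal.ofReal_le_ofReal ?_
  have h1 : M.toReal ≤ (M.toReal + 1) ^ (i + j + k + 1) :=
    (by linarith : M.toReal ≤ M.toReal + 1).trans (le_self_pow₀ (by linarith) (by omega))
  calc _ ≤ (M.toReal + 1) ^ (i + j + k + 1) * gevreyBound C i j k :=
        mul_le_mul_of_nonneg_right h1 (gevreyBound_nonneg hC.le _ _ _)
    _ = _ := by
        rw [gevreyBound, gevreyBound, mul_pow]
        ring

/-! ### The power series in `s` -/

lemma term_eq (a r : ℝ) (P m : ℕ) (d t s : ℝ) :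
    term a r P 0 0 m (d, t, s) =
      (m : ℝ) ^ P * term a r 0 0 0 m (d, t, 0) * Real.cosh (a * m * s) := by
  simp only [term, hyp_zero, mul_zero, Real.cosh_zero, pow_zero, one_mul, mul_one]
  ring

/-- Expand `cosh(a m s)` and exchange the sums. Only even powers with positive coefficients occur,
so the absolute values in row `m` add up to the absolute value of the term itself, which is summable
in `m`. -/
lemma hasSum_series {a r : ℝ} (hr : 0 < r) (ha : 0 ≤ a) {d t s : ℝ}
    (hx : (d, t, s) ∈ slab r) :
    HasSum (fun k : ℕ => (a ^ 2) ^ k * series a r (2 * k) 0 0 (d, t, 0) /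
      (Nat.factorial (2 * k) : ℝ) * s ^ (2 * k)) (series a r 0 0 0 (d, t, s)) := by
  set F : ℕ × ℕ → ℝ := fun p => term a r 0 0 0 p.1 (d, t, 0) *
    ((a * p.1 * s) ^ (2 * p.2) / (Nat.factorial (2 * p.2) : ℝ)) with hF
  have hrow : ∀ m, HasSum (fun k => F (m, k)) (term a r 0 0 0 m (d, t, s)) := fun m => by
    rw [term_eq, pow_zero, one_mul]
    exact (Real.hasSum_cosh _).mul_left _
  have hrow' : ∀ m, HasSum (fun k => |F (m, k)|) |term a r 0 0 0 m (d, t, s)| := fun m => by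
    rw [term_eq, pow_zero, one_mul, abs_mul, abs_of_pos (Real.cosh_pos _)]
    refine ((Real.hasSum_cosh _).mul_left _).congr_fun ?_
    intro k
    simp only [hF]
    rw [abs_mul, abs_div, abs_of_nonneg (Even.pow_nonneg (even_two_mul k) (a * m * s)),
      Nat.abs_cast]
  have hsum : Summable F := by
    refine Summable.of_abs ((summable_prod_of_nonneg fun _ => abs_nonneg _).2
      ⟨fun m => (hrow' m).summable, ?_⟩)
    simp only [(hrow' _).tsum_eq]
    exact (summable_term ha 0 0 0 hx).abs
  have htot : HasSum F (series a r 0 0 0 (d, t, s)) := by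
    have h := hsum.hasSum.prod_fiberwise hrow
    rw [series, h.tsum_eq]
    exact hsum.hasSum
  have hx0 : (d, t, (0 : ℝ)) ∈ slab r := slice_mem_slab (y := (d, t)) hr hx.1
  refine ((Equiv.prodComm ℕ ℕ).hasSum_iff.2 htot).prod_fiberwise fun k => ?_
  refine (((summable_term ha (2 * k) 0 0 hx0).hasSum.mul_left ((a ^ 2) ^ k)).div_const
    (Nat.factorial (2 * k) : ℝ) |>.mul_right (s ^ (2 * k))).congr_fun fun m => ?_
  change term a r 0 0 0 m (d, t, 0) *
    ((a * m * s) ^ (2 * k) / (Nat.factorial (2 * k) : ℝ)) = _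
  rw [term_eq a r (2 * k), mul_zero, Real.cosh_zero, mul_one, mul_pow, mul_pow,
    ← pow_mul]
  ring

/-! ### The boundary expansion -/

lemma hasDerivWithinAt_series {a r : ℝ} (hr : 0 < r) (ha : 0 ≤ a) (P j l : ℕ) {d y t s : ℝ}
    (hs : s ∈ Icc (-r) r) (hy : y ∈ Icc 0 d) :
    HasDerivWithinAt (fun y => series a r P j l (y, t, s))
      (series a r (P + 2) (j + 2) l (y, t, s)) (Icc 0 d) y := by
  have hp : HasDerivWithinAt (fun y : ℝ => (y, t, s)) (1, 0, 0) (Icc 0 d) y :=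
    ((hasDerivAt_id y).prodMk ((hasDerivAt_const y t).prodMk
      (hasDerivAt_const y s))).hasDerivWithinAt
  have hm : MapsTo (fun y : ℝ => (y, t, s)) (Icc 0 d) (slab r) :=
    fun z hz => ⟨hz.1, mem_univ _, hs⟩
  have h := (hasFDerivWithinAt_series hr ha P j l (hm hy)).comp_hasDerivWithinAt y hp hm
  exact h.congr_deriv (by simp [seriesDeriv])

/-- The `d`-derivative of a Taylor remainder is the remainder, one order lower, of the series with
shifted indices; the mean value inequality integrates the bound. The lost `1/m!` does not matter. -/
lemma abs_series_sub_taylor_le {a r : ℝ} (hr : 0 < r) (ha : 0 ≤ a) (l m : ℕ) (P j : ℕ)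
    {d t s : ℝ} (hs : s ∈ Icc (-r) r) (hd : 0 ≤ d) :
    |series a r P j l (d, t, s) - ∑ k ∈ Finset.range m,
      series a r (P + 2 * k) (j + 2 * k) l (0, t, s) / k.factorial * d ^ k| ≤
      (P + 2 * m).factorial * expSum * d ^ m := by
  induction m generalizing P j d with
  | zero => simpa using abs_series_le ha P j l (x := (d, t, s)) ⟨hd, mem_univ _, hs⟩
  | succ m ih =>
    set φ : ℝ → ℝ := fun y => series a r P j l (y, t, s) - ∑ k ∈ Finset.range (m + 1),
      series a r (P + 2 * k) (j + 2 * k) l (0, t, s) / k.factorial * y ^ k with hφ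
    have hφ0 : φ 0 = 0 := by
      simp [hφ, Finset.sum_range_succ']
    have hder : ∀ y ∈ Icc 0 d, HasDerivWithinAt φ (series a r (P + 2) (j + 2) l (y, t, s) -
        ∑ k ∈ Finset.range m, series a r (P + 2 + 2 * k) (j + 2 + 2 * k) l (0, t, s) /
          k.factorial * y ^ k) (Icc 0 d) y := by
      intro y hy
      refine (hasDerivWithinAt_series hr ha P j l hs hy).sub ?_
      simp only [Finset.sum_range_succ', pow_zero, mul_one]
      refine HasDerivWithinAt.add_const _ (HasDerivWithinAt.fun_sum fun k _ => ?_)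
      refine ((hasDerivAt_pow (k + 1) y).hasDerivWithinAt.const_mul _).congr_deriv ?_
      rw [show P + 2 * (k + 1) = P + 2 + 2 * k by ring,
        show j + 2 * (k + 1) = j + 2 + 2 * k by ring, Nat.factorial_succ]
      push_cast
      have : (k.factorial : ℝ) ≠ 0 := by positivity
      have : (k : ℝ) + 1 ≠ 0 := by positivity
      field_simp
    have hb := norm_image_sub_le_of_norm_deriv_le_segment' hder
      (C := (P + 2 * (m + 1)).factorial * expSum * d ^ m) (fun y hy => ?_) d ⟨hd, le_rfl⟩
    · rw [hφ0, sub_zero, sub_zero, mul_assoc, ← pow_succ] at hb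
      exact hb
    · refine (ih (P + 2) (j + 2) hy.1).trans ?_
      have hS := expSum_nonneg
      rw [show P + 2 + 2 * m = P + 2 * (m + 1) by ring]
      have hy0 := hy.1
      have hyd := hy.2.le
      gcongr

/-- The coefficients of the boundary expansion. -/
noncomputable def boundaryCoeff (a r : ℝ) (q k : ℕ) (y : ℝ × ℝ) : ℝ :=
  if k < q then 0 else
    series a r (2 * (k - q)) (2 * (k - q)) 0 (0, y.1, y.2) / (k - q).factorial

lemma isBoundaryExpansion_pow_mul_series {a r : ℝ} (hr : 0 < r) (ha : 0 ≤ a) (q : ℕ) :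
    IsBoundaryExpansion r (fun x => x.1 ^ q * series a r 0 0 0 x) (boundaryCoeff a r q) := by
  have hS := expSum_nonneg
  intro m
  rcases lt_or_ge m q with hm | hm
  -- All coefficients in the partial sum vanish, and `d^q` itself is `O(d^(m+1))`.
  · refine ⟨(1 + r) ^ q * expSum, fun x hx => ?_⟩
    have hx0 : 0 ≤ x.1 := hx.1.le
    rw [Finset.sum_eq_zero fun k hk => by
      rw [boundaryCoeff, if_pos (by have := Finset.mem_range.1 hk; omega), zero_mul], sub_zero,
      abs_mul, abs_of_nonneg (by positivity), show q = (m + 1) + (q - (m + 1)) by omega, pow_add]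
    have h1 := abs_series_le ha 0 0 0 (openSlab_subset_slab hr (domG_subset_openSlab hr hx))
    have h2 : x.1 ^ (q - (m + 1)) ≤ (1 + r) ^ ((m + 1) + (q - (m + 1))) :=
      (pow_le_pow_left₀ hx0 (by linarith [hx.2.1]) _).trans
        (pow_le_pow_right₀ (by linarith) (by omega))
    rw [Nat.factorial_zero, Nat.cast_one, one_mul] at h1
    calc _ ≤ x.1 ^ (m + 1) * (1 + r) ^ ((m + 1) + (q - (m + 1))) * expSum := by gcongr
      _ = _ := by ring
  · obtain ⟨p, rfl⟩ := Nat.exists_eq_add_of_le hm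
    refine ⟨(2 * (p + 1)).factorial * expSum, fun x hx => ?_⟩
    have hx0 : 0 ≤ x.1 := hx.1.le
    have hs := (openSlab_subset_slab hr (domG_subset_openSlab hr hx)).2.2
    have h := abs_series_sub_taylor_le hr ha 0 (p + 1) 0 0 (t := x.2.1) hs hx0
    rw [add_assoc, Finset.sum_range_add, Finset.sum_eq_zero (s := Finset.range q) fun k hk => by
      rw [boundaryCoeff, if_pos (Finset.mem_range.1 hk), zero_mul], zero_add]
    have he : ∑ k ∈ Finset.range (p + 1), boundaryCoeff a r q (q + k) x.2 * x.1 ^ (q + k)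
        = x.1 ^ q * ∑ k ∈ Finset.range (p + 1),
          series a r (0 + 2 * k) (0 + 2 * k) 0 (0, x.2.1, x.2.2) / k.factorial * x.1 ^ k := by
      rw [Finset.mul_sum]
      refine Finset.sum_congr rfl fun k _ => ?_
      rw [boundaryCoeff, if_neg (by omega), Nat.add_sub_cancel_left, zero_add, pow_add]
      ring
    rw [he, ← mul_sub, abs_mul, abs_of_nonneg (by positivity), pow_add x.1 q]
    rw [zero_add] at h
    calc _ ≤ x.1 ^ q * ((2 * (p + 1)).factorial * expSum * x.1 ^ (p + 1)) := by gcongr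
      _ = _ := by ring

lemma series_two_mul_phase (a r : ℝ) (P k l : ℕ) (x : ℝ × ℝ × ℝ) :
    series a r P (2 * k) l x = (-1) ^ k * series a r P 0 l x := by
  induction k with
  | zero => simp
  | succ k ih =>
    rw [mul_add_one, series_add_two_phase, ih, pow_succ]
    ring

/-- All terms are nonnegative at the origin, so the sum dominates each of them. -/
lemma le_series_zero {a r : ℝ} (hr : 0 < r) (ha : 0 ≤ a) (P m : ℕ) :
    (m : ℝ) ^ P * Real.exp (-(a * r + 2) * m) ≤ series a r P 0 0 (0, 0, 0) := by
  have ht : ∀ m : ℕ, term a r P 0 0 m (0, 0, 0)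
      = (m : ℝ) ^ P * Real.exp (-(a * r + 2) * m) := fun m => by
    simp [term, hyp_zero]
  rw [← ht, series]
  refine (summable_term ha P 0 0 (slice_mem_slab (y := (0, 0)) hr le_rfl)).le_tsum m fun k _ => ?_
  exact (ht k).symm ▸ by positivity

lemma not_summable_boundaryCoeff {a r : ℝ} (hr : 0 < r) (ha : 0 ≤ a) (q : ℕ) {d : ℝ}
    (hd : 0 < d) : ¬ Summable fun k => boundaryCoeff a r q k (0, 0) * d ^ k := by
  intro h
  have h0 := ((tendsto_add_atTop_iff_nat q).2 h.tendsto_atTop_zero).abs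
  rw [abs_zero] at h0
  have hev := h0.eventually (gt_mem_nhds (show 0 < d ^ q by positivity))
  -- Once `k ≥ e^(a r + 2) / d`, the term of index `k + q` is at least `d^q` in absolute value and
  -- cannot tend to zero.
  obtain ⟨k, hk, hk1⟩ := (hev.and
    (tendsto_natCast_atTop_atTop.eventually_ge_atTop (Real.exp (a * r + 2) / d))).exists
  refine hk.not_ge ?_
  have hf : (k.factorial : ℝ) ≤ (k : ℝ) ^ k := by exact_mod_cast Nat.factorial_le_pow k
  have hk2 : 1 ≤ k * Real.exp (-(a * r + 2)) * d := by
    rw [div_le_iff₀ hd] at hk1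
    rw [Real.exp_neg]
    have := Real.exp_pos (a * r + 2)
    field_simp
    exact hk1
  rw [boundaryCoeff, if_neg (by omega), Nat.add_sub_cancel, series_two_mul_phase, abs_mul,
    abs_div, abs_mul, abs_pow, abs_neg, abs_one, one_pow, one_mul, Nat.abs_cast,
    abs_of_pos (pow_pos hd _), pow_add]
  have hs := (le_series_zero hr ha (2 * k) k).trans (le_abs_self _)
  have h1 : (k * Real.exp (-(a * r + 2)) : ℝ) ^ k ≤
      |series a r (2 * k) 0 0 (0, 0, 0)| / k.factorial := by
    rw [le_div_iff₀ (by positivity)]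
    refine le_trans ?_ hs
    calc _ ≤ (k * Real.exp (-(a * r + 2)) : ℝ) ^ k * (k : ℝ) ^ k := by gcongr
      _ = _ := by
        rw [mul_pow, ← Real.exp_nat_mul, two_mul, pow_add, mul_comm (k : ℝ) (-(a * r + 2))]
        ring
  calc d ^ q ≤ (k * Real.exp (-(a * r + 2)) * d) ^ k * d ^ q :=
        le_mul_of_one_le_left (by positivity) (one_le_pow₀ hk2)
    _ = (k * Real.exp (-(a * r + 2))) ^ k * (d ^ k * d ^ q) := by
        rw [mul_pow _ d]
        ring
    _ ≤ _ := by gcongr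

/-! ### Non-analyticity -/

/-- Uniqueness of asymptotic expansions: once the lower coefficients vanish, dividing by `d^m` and
letting `d → 0` kills the next. -/
lemma coeff_eq_zero_of_isBigO {e : ℕ → ℝ}
    (h : ∀ m : ℕ, (fun d : ℝ => ∑ k ∈ Finset.range (m + 1), e k * d ^ k)
      =O[𝓝[>] 0] fun d => d ^ (m + 1)) (m : ℕ) : e m = 0 := by
  induction m using Nat.strong_induction_on with
  | _ m ih =>
    have h1 : (fun d : ℝ => e m * d ^ m) =O[𝓝[>] 0] fun d => d ^ (m + 1) := by
      refine (h m).congr_left fun d => ?_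
      rw [Finset.sum_range_succ, Finset.sum_eq_zero fun k hk => by
        rw [ih k (Finset.mem_range.1 hk), zero_mul], zero_add]
    obtain ⟨K, hK⟩ := h1.bound
    have h2 : ∀ᶠ d : ℝ in 𝓝[>] 0, |e m| ≤ K * d := by
      filter_upwards [hK, self_mem_nhdsWithin] with d hd hd0
      have hd0 : 0 < d := hd0
      rw [norm_mul, norm_pow, norm_pow, Real.norm_eq_abs, Real.norm_eq_abs, abs_of_pos hd0,
        pow_succ', ← mul_assoc] at hd
      exact le_of_mul_le_mul_right hd (by positivity)
    have h3 : Tendsto (fun d : ℝ => K * d) (𝓝[>] 0) (𝓝 0) := by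
      have : Tendsto (fun d : ℝ => K * d) (𝓝 0) (𝓝 (K * 0)) := tendsto_id.const_mul K
      rw [mul_zero] at this
      exact this.mono_left nhdsWithin_le_nhds
    exact abs_nonpos_iff.1 (ge_of_tendsto h3 h2)

/-- The power series of an analytic extension is also an asymptotic expansion, so by uniqueness its
coefficients are the `c k`, and it converges at some `d > 0`. -/
lemma exists_summable_of_analyticWithinAt {f : ℝ → ℝ} (hf : AnalyticWithinAt ℝ f (Ici 0) 0)
    {c : ℕ → ℝ} (hc : ∀ m : ℕ, (fun d : ℝ => f d - ∑ k ∈ Finset.range (m + 1), c k * d ^ k)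
      =O[𝓝[>] 0] fun d => d ^ (m + 1)) :
    ∃ d : ℝ, 0 < d ∧ Summable fun k => c k * d ^ k := by
  obtain ⟨g, -, hfg, p, hp⟩ := hf.exists_analyticAt
  have hpc : ∀ k, p.coeff k = c k := fun k => by
    refine sub_eq_zero.1 (coeff_eq_zero_of_isBigO (e := fun k => p.coeff k - c k) (fun m => ?_) k)
    have h1 := ((hp.isBigO_sub_partialSum_pow (m + 1)).mono
      (nhdsWithin_le_nhds (s := Ioi 0)))
    have h1' : (fun d : ℝ => f d - ∑ k ∈ Finset.range (m + 1), p.coeff k * d ^ k)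
        =O[𝓝[>] 0] fun d => d ^ (m + 1) := by
      refine (h1.congr' ?_ ?_)
      · filter_upwards [self_mem_nhdsWithin] with d hd
        rw [zero_add, hfg (mem_insert_of_mem _ (mem_Ici.2 (mem_Ioi.1 hd).le))]
        simp [FormalMultilinearSeries.partialSum, mul_comm]
      · filter_upwards [self_mem_nhdsWithin] with d hd
        rw [Real.norm_eq_abs, abs_of_pos hd]
    refine ((hc m).sub h1').congr_left fun d => ?_
    simp only [sub_mul, Finset.sum_sub_distrib]
    ring
  obtain ⟨ρ, hρ⟩ := hp
  obtain ⟨δ, hδ0, hδ⟩ := ENNReal.lt_iff_exists_nnreal_btwn.1 hρ.r_pos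
  have hδ0 : (0 : ℝ) < δ := by exact_mod_cast hδ0
  refine ⟨δ, hδ0, ?_⟩
  have hm : (δ : ℝ) ∈ Metric.eball (0 : ℝ) ρ := by
    simpa [enorm_eq_nnnorm] using hδ
  refine (hρ.hasSum hm).summable.congr fun k => ?_
  simp [← hpc, mul_comm]

lemma isBigO_sub_boundaryCoeff {a r : ℝ} (hr : 0 < r) (ha : 0 ≤ a) (q m : ℕ) :
    (fun d : ℝ => d ^ q * series a r 0 0 0 (d, 0, 0) -
      ∑ k ∈ Finset.range (m + 1), boundaryCoeff a r q k (0, 0) * d ^ k)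
      =O[𝓝[>] 0] fun d => d ^ (m + 1) := by
  obtain ⟨K, hK⟩ := isBoundaryExpansion_pow_mul_series hr ha q m
  refine .of_bound K ?_
  filter_upwards [Ioo_mem_nhdsGT hr] with d hd
  rw [Real.norm_eq_abs, Real.norm_eq_abs, abs_of_pos (pow_pos hd.1 (m + 1))]
  exact hK (d, 0, 0) ⟨hd.1, hd.2, by simpa using by positivity⟩

lemma not_analyticWithinAt_pow_mul_series {a r : ℝ} (hr : 0 < r) (ha : 0 ≤ a) (q : ℕ) :
    ¬ AnalyticWithinAt ℝ (fun d : ℝ => d ^ q * series a r 0 0 0 (d, 0, 0)) (Ici 0) 0 := by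
  intro h
  obtain ⟨d, hd, hs⟩ := exists_summable_of_analyticWithinAt h (isBigO_sub_boundaryCoeff hr ha q)
  exact not_summable_boundaryCoeff hr ha q hd hs

lemma not_analyticWithinAt_series_slice {a r : ℝ} (hr : 0 < r) (ha : 0 ≤ a) :
    ¬ AnalyticWithinAt ℝ (fun y => series a r 0 0 0 (slice y)) (domDbar r)
      ((0 : ℝ), (0 : ℝ)) := by
  intro h
  -- Restriction to the segment `t = 0` reduces to the one-variable statement with `q = 0`.
  have hι : AnalyticWithinAt ℝ (fun d : ℝ => (d, (0 : ℝ))) (Ico 0 r) 0 :=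
    (analyticAt_id.prod analyticAt_const).analyticWithinAt
  have hcomp := AnalyticWithinAt.comp (f := fun d : ℝ => (d, (0 : ℝ))) (x := 0) h hι
    (fun d hd => ⟨hd.1, hd.2, by simpa using by positivity⟩)
  refine not_analyticWithinAt_pow_mul_series hr ha 0 ?_
  simp only [pow_zero, one_mul]
  exact hcomp.mono_of_mem_nhdsWithin (Ico_mem_nhdsGE hr)

end BoundaryExpansion

open BoundaryExpansion

theorem mainTheorem5 (n : ℕ) (r : ℝ) (hr : 0 < r) :
    ∃ (w : ℝ × ℝ → ℝ) (v : ℝ × ℝ × ℝ → ℝ),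
      -- `w` is smooth up to `d = 0`, satisfies the Gevrey estimates, and is not analytic
      ContDiffOn ℝ ((⊤ : ℕ∞) : WithTop ℕ∞) w (BoundaryExpansion.domDbar r) ∧
      BoundaryExpansion.GevreyL2 r w ∧
      BoundaryExpansion.GevreyC2 r w ∧
      ¬ AnalyticWithinAt ℝ w (BoundaryExpansion.domDbar r) ((0 : ℝ), (0 : ℝ)) ∧
      -- `v` is the sum of the convergent series
      (∀ d t s : ℝ, (d, t, s) ∈ BoundaryExpansion.domG r →
        HasSum (fun k : ℕ =>
          (BoundaryExpansion.negAdivD n)^[k] (fun y : ℝ × ℝ => y.1 ^ (n + 1) * w y) (d, t)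
            / (Nat.factorial (2 * k) : ℝ) * s ^ (2 * k)) (v (d, t, s))) ∧
      -- the coefficients contain the factor `d ^ (n + 1)`
      (∀ k : ℕ, ∃ h : ℝ × ℝ → ℝ,
        ContDiffOn ℝ ((⊤ : ℕ∞) : WithTop ℕ∞) h (BoundaryExpansion.domDbar r) ∧
        ∀ x ∈ BoundaryExpansion.domD r,
          (BoundaryExpansion.negAdivD n)^[k] (fun y : ℝ × ℝ => y.1 ^ (n + 1) * w y) x
            = x.1 ^ (n + 1) * h x) ∧
      -- `v` is a solution, smooth up to `d = 0` and of Gevrey order two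
      ContDiffOn ℝ ((⊤ : ℕ∞) : WithTop ℕ∞) v (BoundaryExpansion.domGbar r) ∧
      (∀ x ∈ BoundaryExpansion.domG r, BoundaryExpansion.modelOp n v x = 0) ∧
      BoundaryExpansion.GevreyTwo r v ∧
      -- `v` equals `d ^ (n + 1) w` on `s = 0`, and is not analytic in `d` there
      (∀ d t : ℝ, (d, t) ∈ BoundaryExpansion.domDbar r → v (d, t, 0) = d ^ (n + 1) * w (d, t)) ∧
      ¬ AnalyticWithinAt ℝ (fun d : ℝ => v (d, 0, 0)) (Set.Ici 0) 0 ∧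
      -- the boundary expansion starts at order `n + 1`, and it diverges at the origin
      ∃ c : ℕ → ℝ × ℝ → ℝ,
        BoundaryExpansion.IsBoundaryExpansion r v c ∧
        (∀ k ≤ n, ∀ t s : ℝ, t ^ 2 + s ^ 2 < r ^ 2 → c k (t, s) = 0) ∧
        ∀ d : ℝ, 0 < d → ¬ Summable (fun k : ℕ => c k (0, 0) * d ^ k) := by
  -- This value makes `(n + 3) u_d + u_ss` vanish on every mode.
  set a : ℝ := √(n + 3)
  have ha : 0 ≤ a := Real.sqrt_nonneg _
  have ha2 : a ^ 2 = n + 3 := Real.sq_sqrt (by positivity)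
  have hslice : MapsTo slice (domDbar r) (slab r) := fun y hy => slice_mem_slab hr hy.1
  have hsmooth : ∀ P, ContDiffOn ℝ ((⊤ : ℕ∞) : WithTop ℕ∞)
      (fun y => series a r P 0 0 (slice y)) (domDbar r) := fun P =>
    (contDiffOn_series hr ha P 0 0).comp
      (contDiff_fst.prodMk (contDiff_snd.prodMk contDiff_const)).contDiffOn hslice
  refine ⟨fun y => series a r 0 0 0 (slice y), fun x => x.1 ^ (n + 1) * series a r 0 0 0 x,
    hsmooth 0, (gevreyC2_series hr ha).gevreyL2, gevreyC2_series hr ha,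
    not_analyticWithinAt_series_slice hr ha, fun d t s hx => ?_, fun k => ?_,
    (contDiff_fst.pow (n + 1)).contDiffOn.mul
      ((contDiffOn_series hr ha 0 0 0).mono (domGbar_subset_slab hr)),
    fun x hx => modelOp_pow_mul_series hr ha n ha2 (domG_subset_openSlab hr hx),
    gevreyTwo_pow_mul_series hr ha (n + 1), fun d t _ => rfl,
    not_analyticWithinAt_pow_mul_series hr ha (n + 1), boundaryCoeff a r (n + 1),
    isBoundaryExpansion_pow_mul_series hr ha (n + 1),
    fun k hk t s _ => if_pos (Nat.lt_succ_of_le hk),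
    fun d hd => not_summable_boundaryCoeff hr ha (n + 1) hd⟩
  · have h := (hasSum_series hr ha
      (openSlab_subset_slab hr (domG_subset_openSlab hr hx))).mul_left (d ^ (n + 1))
    refine h.congr_fun fun k => ?_
    rw [negAdivD_iterate_pow_mul_series hr ha n k (x := (d, t)) ⟨hx.1, mem_univ _⟩, ha2]
    simp only [slice]
    ring
  · refine ⟨fun y => ((n : ℝ) + 3) ^ k * series a r (2 * k) 0 0 (slice y),
      contDiffOn_const.mul (hsmooth _), fun x hx => ?_⟩
    rw [negAdivD_iterate_pow_mul_series hr ha n k (domD_subset_openStrip r hx)]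
    ring
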